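/- A sequence $(a_1,\dots,a_n)$ with $1\le a_i\le n$ is a parking function of length $n$ if, when $n$ cars arrive one after another at spaces $1,\dots,n$ and car $i$ takes the first unoccupied space $s\ge a_i$, every car finds a space. Let $p_n^l$ be the number of parking functions of length $n$ with $a_1=l$. Consider the formal power series over $\mathbb{Q}$ $$P(x)=\sum_{n\ge0}\frac{(n+1)^{n-1}}{n!}x^n,\quad L(x)=\sum_{n\ge1}\frac{p_n^1}{(n-1)!}x^n,\quad T_k(x)=\sum_{n\ge k+1}\frac{p_n^{n-k}}{(n-1)!}x^n\ (k\ge0),\quad T(x,y)=\sum_{k\ge0}T_k(x)y^k.$$ Then the following hold. (1) $L(x)+xL'(x)=2xP'(x)$ and $T_0(x)+xT_0'(x)=2xP(x)+x^2P'(x)$; furthermore $L(x)=x[P(x)]^2$ and $T_0(x)=xP(x)$. (2) For every $k\ge1$, $$T_k(x)=T_{k-1}(x)+\frac{(k+1)^{k-1}}{k!}x^{k+1}P(x)-\frac{2(k+1)^{k-2}}{(k-1)!}x^k,$$ and, equivalently, $$T_k(x)=P(x)\sum_{i=0}^{k}\frac{(i+1)^{i-1}}{i!}x^{i+1}-\sum_{i=1}^{k}\frac{2(i+1)^{i-2}}{(i-1)!}x^i.$$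 (3) In $\mathbb{Q}[[x,y]]$, $$(1-y)\left[T(x,y)+x\frac{\partial T(x,y)}{\partial x}\right]=2xP(x)P(xy)+x^2P(xy)P'(x)+x^2yP(x)P'(xy)-2xyP'(xy),$$ $$T(x,y)-xP(x)=yT(x,y)+xP(x)[P(xy)-1]-xy[P(xy)]^2,$$ and $$T(x,y)=\frac{xP(xy)[P(x)-yP(xy)]}{1-y}.$$ -/

import Mathlib

open scoped Nat PowerSeries

noncomputable section

namespace Parking

/-- The preference sets `(a_1, …, a_n)` with `1 ≤ a_i ≤ n` (`n` cars, `n` spaces numbered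
`1, …, n`); the `i`-th entry, counted from `1`, is the value at the index `i - 1` of `Fin n`. -/
def preferenceSets (n : ℕ) : Finset (Fin n → ℕ) :=
  Fintype.piFinset fun _ => Finset.Icc 1 n

/-- `a` is a parking function: the cars arrive in the order of their indices, car `i` takes the
first space `s ≥ a i` among the `n` spaces that no earlier car has taken, and every car finds a
space. Here `σ i` is the space taken by car `i`. -/
def IsParkingFunction {n : ℕ} (a : Fin n → ℕ) : Prop :=
  a ∈ preferenceSets n ∧
    ∃ σ : Fin n → ℕ, ∀ i, IsLeast {s : ℕ | a i ≤ s ∧ s ≤ n ∧ ∀ j < i, σ j ≠ s} (σ i)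

open Classical in
/-- `p_n^l`: the number of parking functions of length `n` with leading term `a_1 = l`. -/
def leadCount (n l : ℕ) : ℕ :=
  ((preferenceSets n).filter fun a =>
    IsParkingFunction a ∧ ∃ h : 0 < n, a ⟨0, h⟩ = l).card

/-- `P(x) = ∑_{n ≥ 0} (n+1)^{n-1} / n! x^n`. -/
def P : ℚ⟦X⟧ :=
  PowerSeries.mk fun n => ((n : ℚ) + 1) ^ ((n : ℤ) - 1) / (n ! : ℚ)

/-- `L(x) = ∑_{n ≥ 1} p_n^1 / (n-1)! x^n`. -/
def L : ℚ⟦X⟧ :=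
  PowerSeries.mk fun n => if 1 ≤ n then (leadCount n 1 : ℚ) / ((n - 1)! : ℚ) else 0

/-- `T_k(x) = ∑_{n ≥ k+1} p_n^{n-k} / (n-1)! x^n`. -/
def T (k : ℕ) : ℚ⟦X⟧ :=
  PowerSeries.mk fun n =>
    if k + 1 ≤ n then (leadCount n (n - k) : ℚ) / ((n - 1)! : ℚ) else 0

/-! Bivariate series are power series in `y` over `ℚ⟦x⟧`. -/

/-- The variable `x` of `ℚ⟦x⟧⟦y⟧`. -/
def x : ℚ⟦X⟧⟦X⟧ := PowerSeries.C PowerSeries.X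

/-- The variable `y` of `ℚ⟦x⟧⟦y⟧`. -/
def y : ℚ⟦X⟧⟦X⟧ := PowerSeries.X

/-- `f(x)` as an element of `ℚ⟦x⟧⟦y⟧`. -/
def inX (f : ℚ⟦X⟧) : ℚ⟦X⟧⟦X⟧ := PowerSeries.C f

/-- `f(xy)`: the series `f(y)`, with `y` rescaled by the factor `x`. -/
def inXY (f : ℚ⟦X⟧) : ℚ⟦X⟧⟦X⟧ :=
  PowerSeries.rescale (PowerSeries.X : ℚ⟦X⟧) (PowerSeries.map PowerSeries.C f)

/-- The formal partial derivative `∂/∂x` on `ℚ⟦x⟧⟦y⟧`. -/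
def partialX (F : ℚ⟦X⟧⟦X⟧) : ℚ⟦X⟧⟦X⟧ :=
  PowerSeries.mk fun k => PowerSeries.derivative ℚ (PowerSeries.coeff k F)

/-- `T(x,y) = ∑_{k ≥ 0} T_k(x) y^k`. -/
def Txy : ℚ⟦X⟧⟦X⟧ := PowerSeries.mk T

end Parking

end

noncomputable section

namespace Parking

/-! Parking succeeds exactly when, for each `k ≤ n`, at least `k` cars prefer a space `≤ k`. For `m
+ 1` cars, fix the leading term and let the other `m` cars vary: raising the leading term from `r +
1` to `r + 2` weakens this condition only at `k = r + 1`. So the preferences that are lost have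
exactly `r` cars preferring spaces `≤ r + 1`; these form a parking function of length `r`, and the
others, shifted down by `r + 1`, form one of length `m - r`. The loss is thus a binomial convolution
(`ncard_leadSet_diff`).

Telescoping and summing over leading terms gives, for `c n = p_n / n!`, the recursion `(n + 1) c (n
+ 1) = ∑ (i + 1) c i c (n - i)`, equivalent to `P' = (xP)' P`. Abel's identity shows that the
coefficients of `P` satisfy it, so `p_n = (n + 1)^(n - 1)`. Hence the coefficient of `x^(m + 1)` in
`T_k` is the partial convolution `∑_{i ≤ k} c i c (m - i)` for `k ≤ m` (`coeff_succ_T`). The claims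
about `L`, `T_k` and `T(x,y)` are read off from this, with `P' = (xP)' P` supplying the coefficients
of `P ^ 2` and the differential equations. -/

/-! ### The counting criterion for parking functions -/

theorem greedy_injective {n : ℕ} {σ : Fin n → ℕ} (h : ∀ i, ∀ j < i, σ j ≠ σ i) :
    Function.Injective σ := by
  intro i j hij
  rcases lt_trichotomy i j with hlt | heq | hlt
  · exact absurd hij (h j i hlt)
  · exact heq
  · exact absurd hij.symm (h i j hlt)

/-- On an unbounded street every car finds a space, so the process is defined for all preferences;
whether it stays within `n` spaces is decided afterwards. -/
theorem exists_greedy {n : ℕ} (a : Fin n → ℕ) :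
    ∃ σ : Fin n → ℕ, ∀ i, IsLeast {s : ℕ | a i ≤ s ∧ ∀ j < i, σ j ≠ s} (σ i) := by
  let F : (i : Fin n) → ((j : Fin n) → j < i → ℕ) → ℕ :=
    fun i f => sInf {s : ℕ | a i ≤ s ∧ ∀ j (h : j < i), f j h ≠ s}
  let σ : Fin n → ℕ := (wellFounded_lt (α := Fin n)).fix F
  have hσ : ∀ i, σ i = sInf {s : ℕ | a i ≤ s ∧ ∀ j < i, σ j ≠ s} := fun i =>
    (wellFounded_lt (α := Fin n)).fix_eq F i
  refine ⟨σ, fun i => ?_⟩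
  have hne : {s : ℕ | a i ≤ s ∧ ∀ j < i, σ j ≠ s}.Nonempty := by
    obtain ⟨s, hs⟩ := (Set.infinite_of_not_bddAbove
      (not_bddAbove_Ici (a := a i))).exists_notMem_finset (Finset.univ.image σ)
    refine ⟨s, hs.1, fun j _ hj => hs.2 ?_⟩
    simp [← hj]
  constructor
  · conv_rhs => rw [hσ i]
    exact Nat.sInf_mem hne
  · intro s hs
    rw [hσ i]
    exact Nat.sInf_le hs

theorem isParkingFunction_iff {n : ℕ} (a : Fin n → ℕ) :
    IsParkingFunction a ↔
      (∀ i, 1 ≤ a i) ∧ ∀ k ≤ n, k ≤ (Finset.univ.filter fun i => a i ≤ k).card := by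
  constructor
  · rintro ⟨ha, σ, hσ⟩
    have ha' : ∀ i, 1 ≤ a i := fun i => by
      have := Fintype.mem_piFinset.1 ha i
      simp at this; exact this.1
    refine ⟨ha', fun k hk => ?_⟩
    have hinj : Function.Injective σ := greedy_injective fun i => (hσ i).1.2.2
    have himg : Finset.univ.image σ = Finset.Icc 1 n := by
      apply Finset.eq_of_subset_of_card_le
      · intro s hs
        obtain ⟨i, -, rfl⟩ := Finset.mem_image.1 hs
        exact Finset.mem_Icc.2 ⟨(ha' i).trans (hσ i).1.1, (hσ i).1.2.1⟩
      · rw [Finset.card_image_of_injective _ hinj]; simp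
    -- All spaces are filled, and a car in a space `≤ k` prefers a space `≤ k`.
    have hsub : Finset.Icc 1 k ⊆ (Finset.univ.filter fun i => a i ≤ k).image σ := by
      intro s hs
      rw [Finset.mem_Icc] at hs
      have : s ∈ Finset.univ.image σ := by
        rw [himg, Finset.mem_Icc]; omega
      obtain ⟨i, -, rfl⟩ := Finset.mem_image.1 this
      exact Finset.mem_image_of_mem _ (by simpa using (hσ i).1.1.trans hs.2)
    simpa using (Finset.card_le_card hsub).trans Finset.card_image_le
  · rintro ⟨h1, hk⟩
    obtain ⟨σ, hσ⟩ := exists_greedy a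
    have hinj : Function.Injective σ := greedy_injective fun i => (hσ i).1.2
    have hall : ∀ s ∈ Finset.Icc 1 n, s ∈ Finset.univ.image σ := by
      intro s hs
      rw [Finset.mem_Icc] at hs
      -- If `s` stays free, each car preferring a space `≤ s` parks strictly before `s`, so there
      -- are at most `s - 1` such cars.
      by_contra hfree
      have hfree' : ∀ j, σ j ≠ s := by simpa using hfree
      have hsub : (Finset.univ.filter fun i => a i ≤ s).image σ ⊆ Finset.Ico 1 s := by
        intro t ht
        obtain ⟨i, hi, rfl⟩ := Finset.mem_image.1 ht
        have hi : a i ≤ s := by simpa using hi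
        exact Finset.mem_Ico.2 ⟨(h1 i).trans (hσ i).1.1,
          lt_of_le_of_ne ((hσ i).2 ⟨hi, fun j _ => hfree' j⟩) (hfree' i)⟩
      have h := Finset.card_le_card hsub
      rw [Finset.card_image_of_injective _ hinj, Nat.card_Ico] at h
      have := hk s hs.2
      omega
    have himg : Finset.Icc 1 n = Finset.univ.image σ :=
      Finset.eq_of_subset_of_card_le hall
        (by rw [Finset.card_image_of_injective _ hinj]; simp)
    have hle : ∀ i, σ i ≤ n := fun i => by
      have : σ i ∈ Finset.Icc 1 n := by simp [himg]
      exact (Finset.mem_Icc.1 this).2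
    refine ⟨Fintype.mem_piFinset.2 fun i => Finset.mem_Icc.2
      ⟨h1 i, (hσ i).1.1.trans (hle i)⟩, σ, fun i => ⟨⟨(hσ i).1.1, hle i, (hσ i).1.2⟩, ?_⟩⟩
    intro s hs
    exact (hσ i).2 ⟨hs.1, hs.2.2⟩

/-! ### Splitting parking functions by leading term -/

/-- The number of cars whose preference is at most `k`. -/
def countLE {ι : Type*} [Fintype ι] (b : ι → ℕ) (k : ℕ) : ℕ :=
  (Finset.univ.filter fun i => b i ≤ k).card

/-- Parking functions with cars indexed by an arbitrary finite type. -/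
def parkingSet (ι : Type*) [Fintype ι] : Set (ι → ℕ) :=
  {b | (∀ i, 1 ≤ b i) ∧ ∀ k ≤ Fintype.card ι, k ≤ countLE b k}

/-- The preferences of the remaining cars in parking functions whose leading term is `l`. -/
def leadSet (ι : Type*) [Fintype ι] (l : ℕ) : Set (ι → ℕ) :=
  {b | (∀ i, 1 ≤ b i) ∧ ∀ k ≤ Fintype.card ι + 1, k ≤ countLE b k + if l ≤ k then 1 else 0}

/-- Parking functions on `S` and on its complement, the latter shifted by `r`. -/
def glue {ι : Type*} [DecidableEq ι] (S : Finset ι) (r : ℕ)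
    (p : ({i // i ∈ S} → ℕ) × ({i // i ∉ S} → ℕ)) :
    ι → ℕ :=
  fun i => if h : i ∈ S then p.1 ⟨i, h⟩ else p.2 ⟨i, h⟩ + r

theorem glue_injective {ι : Type*} [DecidableEq ι] (S : Finset ι) (r : ℕ) :
    Function.Injective (glue S r) := by
  rintro ⟨u, v⟩ ⟨u', v'⟩ h
  refine Prod.ext (funext fun i => ?_) (funext fun i => ?_)
  · simpa [glue, i.2] using congrFun h i
  · simpa [glue, i.2] using congrFun h i

section
variable {ι : Type*} [Fintype ι]

theorem countLE_le_card (b : ι → ℕ) (k : ℕ) : countLE b k ≤ Fintype.card ι :=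
  Finset.card_le_univ _

theorem le_of_card_le_countLE {b : ι → ℕ} {k : ℕ} (h : Fintype.card ι ≤ countLE b k) (i : ι) :
    b i ≤ k := by
  have := (Finset.card_eq_iff_eq_univ _).1 (le_antisymm (countLE_le_card b k) h)
  have hi : i ∈ Finset.univ.filter fun i => b i ≤ k := by rw [this]; simp
  simpa using hi

theorem countLE_of_le {b : ι → ℕ} {k : ℕ} (h : ∀ i, b i ≤ k) : countLE b k = Fintype.card ι := by
  simp [countLE, h]

theorem countLE_of_lt {b : ι → ℕ} {k : ℕ} (h : ∀ i, k < b i) : countLE b k = 0 := by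
  simp [countLE, h]

theorem le_card_of_mem_parkingSet {b : ι → ℕ} (hb : b ∈ parkingSet ι) (i : ι) :
    b i ≤ Fintype.card ι :=
  le_of_card_le_countLE (hb.2 _ le_rfl) i

theorem le_card_of_mem_leadSet {l : ℕ} {b : ι → ℕ} (hb : b ∈ leadSet ι l) (i : ι) :
    b i ≤ Fintype.card ι + 1 := by
  refine le_of_card_le_countLE ?_ i
  have := hb.2 _ le_rfl
  split_ifs at this <;> omega

theorem finite_parkingSet : (parkingSet ι).Finite := by
  classical
  exact (Set.finite_Iic (fun _ : ι => Fintype.card ι)).subset fun _ hb i =>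
    le_card_of_mem_parkingSet hb i

theorem finite_leadSet (l : ℕ) : (leadSet ι l).Finite := by
  classical
  exact (Set.finite_Iic (fun _ : ι => Fintype.card ι + 1)).subset fun _ hb i =>
    le_card_of_mem_leadSet hb i

theorem leadSet_eq_empty {l : ℕ} (hl : Fintype.card ι + 1 < l) : leadSet ι l = ∅ := by
  ext b
  simp only [Set.mem_empty_iff_false, iff_false]
  intro hb
  have h := hb.2 _ le_rfl
  have := countLE_le_card b (Fintype.card ι + 1)
  rw [if_neg (by omega)] at h
  omega

theorem leadSet_antitone : Antitone (leadSet ι) := by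
  intro l l' hl b hb
  refine ⟨hb.1, fun k hk => (hb.2 k hk).trans ?_⟩
  split_ifs <;> omega

theorem countLE_comp {κ : Type*} [Fintype κ] (e : κ ≃ ι) (b : ι → ℕ) (k : ℕ) :
    countLE (b ∘ e) k = countLE b k := by
  simp only [countLE, Finset.card_filter, Function.comp]
  exact e.sum_comp fun i => if b i ≤ k then 1 else 0

theorem ncard_parkingSet_congr {κ : Type*} [Fintype κ] (e : κ ≃ ι) :
    (parkingSet κ).ncard = (parkingSet ι).ncard := by
  have hmem : ∀ b : ι → ℕ, b ∘ e ∈ parkingSet κ ↔ b ∈ parkingSet ι := fun b => by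
    simp [parkingSet, countLE_comp, Fintype.card_congr e, e.forall_congr_left]
  have : parkingSet κ = (fun b : ι → ℕ => b ∘ e) '' parkingSet ι := by
    ext c
    constructor
    · intro hc
      refine ⟨c ∘ e.symm, ?_, by ext; simp⟩
      rw [← hmem]
      convert hc using 1
      ext; simp
    · rintro ⟨b, hb, rfl⟩
      exact (hmem b).2 hb
  rw [this, Set.ncard_image_of_injective _ e.surjective.injective_comp_right]

theorem countLE_glue [DecidableEq ι] (S : Finset ι) (r k : ℕ)
    (p : ({i // i ∈ S} → ℕ) × ({i // i ∉ S} → ℕ)) :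
    countLE (glue S r p) k = countLE p.1 k + countLE (fun i => p.2 i + r) k := by
  simp only [countLE, Finset.card_filter]
  rw [← Fintype.sum_subtype_add_sum_subtype (fun i => i ∈ S)]
  congr 1
  · refine Finset.sum_congr (by ext; simp) fun i _ => ?_
    simp [glue]
  · refine Fintype.sum_congr _ _ fun i => ?_
    simp [glue, i.2]

theorem countLE_add (b : ι → ℕ) (r k : ℕ) : countLE (fun i => b i + r) (k + r) = countLE b k := by
  simp [countLE]

theorem countLE_of_mem_diff {r : ℕ} {b : ι → ℕ} (hb : b ∈ leadSet ι (r + 1) \ leadSet ι (r + 2)) :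
    countLE b (r + 1) = r := by
  obtain ⟨h1, h2⟩ := hb
  have : ∃ k ≤ Fintype.card ι + 1, countLE b k + (if r + 2 ≤ k then 1 else 0) < k := by
    by_contra! hcon
    exact h2 ⟨h1.1, hcon⟩
  obtain ⟨k, hk, hlt⟩ := this
  have hle := h1.2 k hk
  -- The indicators of `r + 1 ≤ k` and `r + 2 ≤ k` differ only here.
  have hkr : k = r + 1 := by
    split_ifs at hlt hle <;> omega
  subst hkr
  simp at hlt hle
  omega

/-- The leading car fills the one place among `1, …, r + 1` that the `r` cars of `S` leave over. The
counting condition therefore decouples into one for `S` (at `k ≤ r`) and one for its complement (at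
`k + r + 1`). -/
theorem leadSet_diff_fiber [DecidableEq ι] (S : Finset ι) (r : ℕ) (hS : S.card = r) :
    {b | b ∈ leadSet ι (r + 1) \ leadSet ι (r + 2) ∧
        (Finset.univ.filter fun i => b i ≤ r + 1) = S} =
      glue S (r + 1) '' (parkingSet {i // i ∈ S} ×ˢ parkingSet {i // i ∉ S}) := by
  have hcS : Fintype.card {i // i ∈ S} = r := by simp [hS]
  have hcSc : Fintype.card {i // i ∉ S} + r = Fintype.card ι := by
    have := Fintype.card_subtype_compl (fun i => i ∈ S)
    have h2 := Fintype.card_subtype_le (fun i => i ∈ S)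
    omega
  ext b
  constructor
  · rintro ⟨⟨hb, hb'⟩, hfil⟩
    have hmem : ∀ i, i ∈ S ↔ b i ≤ r + 1 := fun i => by rw [← hfil]; simp
    let p : ({i // i ∈ S} → ℕ) × ({i // i ∉ S} → ℕ) := (fun i => b i, fun i => b i - (r + 1))
    have hp : glue S (r + 1) p = b := by
      ext i
      by_cases hi : i ∈ S
      · simp [glue, hi, p]
      · have := (hmem i).not.1 hi
        simp only [glue, hi, p, dite_false]
        omega
    have hv : ∀ i, 1 ≤ p.2 i := fun i => by
      have := (hmem i).not.1 i.2
      simp only [p]; omega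
    have hcount := fun k => countLE_glue S (r + 1) k p
    rw [hp] at hcount
    refine ⟨p, ⟨⟨fun i => hb.1 i, fun k hk => ?_⟩, ⟨hv, fun k hk => ?_⟩⟩, hp⟩
    · rw [hcS] at hk
      have h := hb.2 k (by omega)
      rw [hcount, if_neg (by omega), countLE_of_lt (b := fun i => p.2 i + (r + 1))] at h
      · simpa using h
      · intro i; omega
    · have h := hb.2 (k + (r + 1)) (by omega)
      rw [hcount, countLE_add, if_pos (by omega)] at h
      have := countLE_le_card p.1 (k + (r + 1))
      omega
  · rintro ⟨p, ⟨hu, hv⟩, rfl⟩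
    have hu' := le_card_of_mem_parkingSet hu
    rw [hcS] at hu'
    have hfil : (Finset.univ.filter fun i => glue S (r + 1) p i ≤ r + 1) = S := by
      ext i
      by_cases hi : i ∈ S
      · have := hu' ⟨i, hi⟩
        have hg : glue S (r + 1) p i = p.1 ⟨i, hi⟩ := by simp [glue, hi]
        rw [Finset.mem_filter_univ, hg]
        exact iff_of_true (by omega) hi
      · have := hv.1 ⟨i, hi⟩
        have hg : glue S (r + 1) p i = p.2 ⟨i, hi⟩ + (r + 1) := by simp [glue, hi]
        rw [Finset.mem_filter_univ, hg]
        exact iff_of_false (by omega) hi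
    have hone : ∀ i, 1 ≤ glue S (r + 1) p i := by
      intro i
      by_cases hi : i ∈ S
      · simpa [glue, hi] using hu.1 ⟨i, hi⟩
      · have := hv.1 ⟨i, hi⟩
        simp only [glue, hi, dite_false]
        omega
    refine ⟨⟨⟨hone, fun k hk => ?_⟩, fun hmem => ?_⟩, hfil⟩
    · rw [countLE_glue]
      by_cases hkr : k ≤ r
      · have := hu.2 k (by omega)
        omega
      · obtain ⟨j, rfl⟩ : ∃ j, k = j + (r + 1) := ⟨k - (r + 1), by omega⟩
        have := hv.2 j (by omega)
        rw [countLE_add, if_pos (by omega), countLE_of_le (fun i => (hu' i).trans (by omega)), hcS]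
        omega
    -- At `k = r + 1` only the `r` cars of `S` count, one too few.
    · by_cases hr : r ≤ Fintype.card ι
      · have h := hmem.2 (r + 1) (by omega)
        rw [countLE, hfil, hS] at h
        simp at h
      · omega

end

/-! ### Counting by convolution -/

/-- The number of parking functions of length `n`. -/
def parkingCount (n : ℕ) : ℕ := (parkingSet (Fin n)).ncard

theorem ncard_parkingSet (ι : Type*) [Fintype ι] :
    (parkingSet ι).ncard = parkingCount (Fintype.card ι) :=
  ncard_parkingSet_congr (Fintype.equivFin ι)

theorem ncard_leadSet_diff (m r : ℕ) :
    (leadSet (Fin m) (r + 1) \ leadSet (Fin m) (r + 2)).ncard =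
      m.choose r * (parkingCount r * parkingCount (m - r)) := by
  have hfin : (leadSet (Fin m) (r + 1) \ leadSet (Fin m) (r + 2)).Finite :=
    (finite_leadSet _).sdiff
  rw [Set.ncard_eq_toFinset_card _ hfin,
    Finset.card_eq_sum_card_fiberwise (f := fun b => Finset.univ.filter fun i => b i ≤ r + 1)
      (t := Finset.powersetCard r Finset.univ)]
  · rw [Finset.sum_congr rfl (g := fun _ => parkingCount r * parkingCount (m - r))]
    · simp
    · intro S hS
      have hS : S.card = r := (Finset.mem_powersetCard.1 hS).2
      have h := congrArg Set.ncard (leadSet_diff_fiber S r hS)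
      rw [Set.ncard_image_of_injective _ (glue_injective _ _), Set.ncard_prod, ncard_parkingSet,
        ncard_parkingSet, Fintype.card_subtype_compl] at h
      simp only [Fintype.card_coe, hS, Fintype.card_fin] at h
      rw [← h, ← Set.ncard_coe_finset]
      congr 1
      ext b
      simp
  · intro b hb
    have := countLE_of_mem_diff (by simpa using hb)
    simpa [Finset.mem_powersetCard, countLE] using this

theorem ncard_leadSet_succ (m r : ℕ) :
    (leadSet (Fin m) (r + 1)).ncard = (leadSet (Fin m) (r + 2)).ncard +
      m.choose r * (parkingCount r * parkingCount (m - r)) := by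
  rw [← ncard_leadSet_diff m r, add_comm (Set.ncard _)]
  have hsub : leadSet (Fin m) (r + 2) ⊆ leadSet (Fin m) (r + 1) := leadSet_antitone (by omega)
  exact (Set.ncard_sdiff_add_ncard_of_subset hsub (finite_leadSet _)).symm

theorem countLE_cons {m : ℕ} (l : ℕ) (b : Fin m → ℕ) (k : ℕ) :
    countLE (Fin.cons l b : Fin (m + 1) → ℕ) k = countLE b k + if l ≤ k then 1 else 0 := by
  simp only [countLE, Finset.card_filter, Fin.sum_univ_succ, Fin.cons_zero, Fin.cons_succ]
  exact add_comm _ _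

theorem cons_mem_parkingSet {m l : ℕ} (hl : 1 ≤ l) (b : Fin m → ℕ) :
    (Fin.cons l b : Fin (m + 1) → ℕ) ∈ parkingSet (Fin (m + 1)) ↔ b ∈ leadSet (Fin m) l := by
  simp [parkingSet, leadSet, countLE_cons, Fin.forall_fin_succ, hl]

theorem mem_parkingSet_iff {n : ℕ} (a : Fin n → ℕ) :
    a ∈ parkingSet (Fin n) ↔ IsParkingFunction a := by
  simp [parkingSet, isParkingFunction_iff, countLE]

theorem setOf_parkingSet_zero_eq {m l : ℕ} (hl : 1 ≤ l) :
    {a | a ∈ parkingSet (Fin (m + 1)) ∧ a 0 = l} =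
      (fun b => (Fin.cons l b : Fin (m + 1) → ℕ)) '' leadSet (Fin m) l := by
  ext a
  constructor
  · rintro ⟨ha, rfl⟩
    refine ⟨Fin.tail a, ?_, Fin.cons_self_tail a⟩
    rw [← cons_mem_parkingSet hl, Fin.cons_self_tail]
    exact ha
  · rintro ⟨b, hb, rfl⟩
    exact ⟨(cons_mem_parkingSet hl b).2 hb, rfl⟩

theorem ncard_setOf_parkingSet_zero_eq {m l : ℕ} (hl : 1 ≤ l) :
    {a | a ∈ parkingSet (Fin (m + 1)) ∧ a 0 = l}.ncard = (leadSet (Fin m) l).ncard := by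
  rw [setOf_parkingSet_zero_eq hl, 
    Set.ncard_image_of_injective _ (Fin.cons_right_injective (α := fun _ => ℕ) l)]

theorem leadCount_eq {m l : ℕ} (hl : 1 ≤ l) :
    leadCount (m + 1) l = (leadSet (Fin m) l).ncard := by
  classical
  rw [← ncard_setOf_parkingSet_zero_eq hl, leadCount, ← Set.ncard_coe_finset]
  congr 1
  ext a
  have : IsParkingFunction a → a ∈ preferenceSets (m + 1) := fun h => h.1
  simp [mem_parkingSet_iff]
  tauto

theorem parkingCount_succ (m : ℕ) :
    parkingCount (m + 1) = ∑ r ∈ Finset.range (m + 1), (leadSet (Fin m) (r + 1)).ncard := by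
  rw [parkingCount, Set.ncard_eq_toFinset_card _ finite_parkingSet,
    Finset.card_eq_sum_card_fiberwise (f := fun a => a 0 - 1) (t := Finset.range (m + 1))]
  · refine Finset.sum_congr rfl fun r _ => ?_
    rw [← ncard_setOf_parkingSet_zero_eq (by omega), ← Set.ncard_coe_finset]
    congr 1
    ext a
    simp only [Finset.coe_filter, Set.Finite.mem_toFinset, Set.mem_ofPred_eq]
    refine and_congr_right fun ha => ?_
    have := ha.1 0
    omega
  · intro a ha
    have ha : a ∈ parkingSet (Fin (m + 1)) := by simpa using ha
    have h1 := le_card_of_mem_parkingSet ha 0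
    have h2 := ha.1 0
    simp at h1 ⊢
    omega

theorem parkingCount_zero : parkingCount 0 = 1 := by
  rw [parkingCount, Set.ncard_eq_one]
  refine ⟨Fin.elim0, ?_⟩
  ext b
  simp only [Set.mem_singleton_iff, Subsingleton.elim b Fin.elim0, iff_true]
  exact ⟨fun i => i.elim0, fun k hk => by simp at hk; omega⟩

theorem ncard_leadSet (m r : ℕ) (hr : r ≤ m + 1) :
    (leadSet (Fin m) (r + 1)).ncard =
      ∑ i ∈ Finset.Ico r (m + 1), m.choose i * (parkingCount i * parkingCount (m - i)) := by
  induction hr using Nat.decreasingInduction with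
  | self => simp [leadSet_eq_empty]
  | of_succ r hr ih =>
    rw [ncard_leadSet_succ m r, ih, Finset.sum_eq_sum_Ico_succ_bot hr, add_comm]

/-! ### Abel's binomial identity -/

theorem alternating_sum_choose_mul_pow_eq_zero {d m : ℕ} (h : d < m) (a : ℚ) :
    ∑ k ∈ Finset.range (m + 1), (-1 : ℚ) ^ (m - k) * m.choose k * (a + k) ^ d = 0 := by
  have h1 := fwdDiff_iter_eq_sum_shift (h := (1 : ℚ)) (fun t : ℚ => t ^ d) m a
  rw [fwdDiff_iter_pow_eq_zero_of_lt h] at h1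
  simpa using h1.symm

theorem choose_mul_choose_sub_comm {n k j : ℕ} (hk : k ≤ n) (hj : j ≤ n) :
    n.choose k * (n - k).choose j = n.choose j * (n - j).choose k := by
  by_cases h : k + j ≤ n
  · have h1 := Nat.choose_mul (n := n) (k := n - k) (s := j) (by omega)
    rw [Nat.choose_symm hk] at h1
    rw [h1, ← Nat.choose_symm (n := n - j) (k := k) (by omega)]
    congr 2
    omega
  · rw [Nat.choose_eq_zero_of_lt (by omega : n - k < j),
      Nat.choose_eq_zero_of_lt (by omega : n - j < k)]
    simp

/-- Abel's binomial identity, with first parameter `1`. -/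
theorem abel_identity (n : ℕ) (z : ℚ) :
    ∑ k ∈ Finset.range (n + 1),
      (n.choose k : ℚ) * ((1 + k : ℚ) ^ ((k : ℤ) - 1) * (z - (1 + k)) ^ (n - k)) = z ^ n := by
  -- Expand in powers of `z`. The exponent is an integer since it equals `-1` when `j = n`, where
  -- only `k = 0`, of base `1`, contributes.
  have hexp : ∀ k ∈ Finset.range (n + 1),
      (n.choose k : ℚ) * ((1 + k : ℚ) ^ ((k : ℤ) - 1) * (z - (1 + k)) ^ (n - k)) =
        ∑ j ∈ Finset.range (n + 1), z ^ j * n.choose j *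
          ((-1) ^ (n - j - k) * (n - j).choose k * (1 + k : ℚ) ^ ((n - j : ℕ) - 1 : ℤ)) := by
    intro k hk
    have hk : k ≤ n := by simpa [Nat.lt_succ_iff] using hk
    rw [sub_eq_add_neg z, add_pow, Finset.mul_sum, Finset.mul_sum,
      ← Finset.sum_subset (Finset.range_subset_range.2 (by omega : n - k + 1 ≤ n + 1))]
    · refine Finset.sum_congr rfl fun j hj => ?_
      have hj : j ≤ n - k := by simpa [Nat.lt_succ_iff] using hj
      have hc : (n.choose k : ℚ) * (n - k).choose j = n.choose j * (n - j).choose k := by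
        exact_mod_cast choose_mul_choose_sub_comm hk (by omega)
      have hne : (1 + k : ℚ) ≠ 0 := by positivity
      have hpow : (1 + k : ℚ) ^ ((n - j : ℕ) - 1 : ℤ) =
          (1 + k : ℚ) ^ ((k : ℤ) - 1) * (1 + k : ℚ) ^ (n - k - j) := by
        rw [← zpow_natCast, ← zpow_add₀ hne]
        congr 1
        omega
      rw [hpow, neg_pow (1 + k : ℚ), Nat.sub_right_comm n j k]
      linear_combination (1 + k : ℚ) ^ ((k : ℤ) - 1) * z ^ j * (-1) ^ (n - k - j) *
        (1 + k : ℚ) ^ (n - k - j) * hc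
    · intro j hj hj'
      simp only [Finset.mem_range] at hj hj'
      rw [Nat.choose_eq_zero_of_lt (by omega : n - j < k)]
      simp
  rw [Finset.sum_congr rfl hexp, Finset.sum_comm, Finset.sum_eq_single n]
  · rw [← Finset.mul_sum, Finset.sum_eq_single 0]
    · simp
    · intro k _ hk
      rw [Nat.choose_eq_zero_of_lt (by omega : n - n < k)]
      simp
    · simp
  -- For `j < n` the inner sum is an `(n - j)`-th finite difference of a polynomial of degree `n - j
  -- - 1`.
  · intro j hj hjn
    have hj : j < n := by
      have := Finset.mem_range.1 hj
      omega
    rw [← Finset.mul_sum,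
      ← Finset.sum_subset (Finset.range_subset_range.2 (by omega : n - j + 1 ≤ n + 1))]
    · have := alternating_sum_choose_mul_pow_eq_zero (by omega : n - j - 1 < n - j) 1
      rw [← mul_zero (z ^ j * n.choose j : ℚ), ← this]
      congr 1
      refine Finset.sum_congr rfl fun k _ => ?_
      rw [← zpow_natCast (1 + k : ℚ), Nat.cast_sub (by omega : 1 ≤ n - j), Nat.cast_one]
    · intro k hk hk'
      simp only [Finset.mem_range] at hk hk'
      rw [Nat.choose_eq_zero_of_lt (by omega : n - j < k)]
      simp
  · simp

/-! ### The series `P`: recursion, differential equation, square -/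

theorem coeff_P (n : ℕ) :
    PowerSeries.coeff n P = ((n : ℚ) + 1) ^ ((n : ℤ) - 1) / (n ! : ℚ) :=
  PowerSeries.coeff_mk _ _

theorem coeff_zero_P : PowerSeries.coeff 0 P = 1 := by
  simp [coeff_P]

theorem succ_mul_coeff_succ_P (n : ℕ) :
    ((n : ℚ) + 1) * PowerSeries.coeff (n + 1) P = ((n : ℚ) + 2) ^ n / (n ! : ℚ) := by
  have h1 : ((n : ℚ) + 1) ≠ 0 := by positivity
  have h2 : (n ! : ℚ) ≠ 0 := by positivity
  rw [coeff_P, Nat.factorial_succ]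
  push_cast
  rw [show (n : ℤ) + 1 - 1 = n by ring, zpow_natCast, show (n : ℚ) + 1 + 1 = n + 2 by ring]
  field_simp

theorem succ_mul_coeff_P (n : ℕ) :
    ((n : ℚ) + 1) * PowerSeries.coeff n P = ((n : ℚ) + 1) ^ n / (n ! : ℚ) := by
  have h1 : ((n : ℚ) + 1) ≠ 0 := by positivity
  rw [coeff_P, zpow_sub_one₀ h1, zpow_natCast]
  field_simp

theorem succ_mul_coeff_succ_P_eq_sum (n : ℕ) :
    ((n : ℚ) + 1) * PowerSeries.coeff (n + 1) P =
      ∑ i ∈ Finset.range (n + 1),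
        ((i : ℚ) + 1) * (PowerSeries.coeff i P * PowerSeries.coeff (n - i) P) := by
  -- Abel's identity at `z = n + 2`; after the reflection `k = n - i` the base `z - (1 + k)` becomes
  -- `i + 1`.
  rw [succ_mul_coeff_succ_P, ← abel_identity, Finset.sum_div, ← Finset.sum_range_reflect]
  refine Finset.sum_congr rfl fun i hi => ?_
  have hi : i ≤ n := by simpa [Nat.lt_succ_iff] using hi
  rw [← mul_assoc (i + 1 : ℚ), succ_mul_coeff_P, coeff_P, show n + 1 - 1 - i = n - i by omega,
    Nat.sub_sub_self hi, Nat.choose_symm hi, Nat.cast_choose ℚ hi]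
  have h1 : (n ! : ℚ) ≠ 0 := by positivity
  have h2 : (i ! : ℚ) ≠ 0 := by positivity
  have h3 : ((n - i)! : ℚ) ≠ 0 := by positivity
  rw [show (n : ℚ) + 2 - (1 + ((n - i : ℕ) : ℚ)) = i + 1 by
    rw [Nat.cast_sub hi]; ring, add_comm (1 : ℚ)]
  field_simp

theorem coeff_P_unique {c : ℕ → ℚ} (h0 : c 0 = 1)
    (h : ∀ n : ℕ, ((n : ℚ) + 1) * c (n + 1) =
      ∑ i ∈ Finset.range (n + 1), ((i : ℚ) + 1) * (c i * c (n - i))) (n : ℕ) :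
    c n = PowerSeries.coeff n P := by
  induction n using Nat.strong_induction_on with
  | _ n ih =>
    cases n with
    | zero => rw [h0, coeff_zero_P]
    | succ n =>
      have hn : ((n : ℚ) + 1) ≠ 0 := by positivity
      apply mul_left_cancel₀ hn
      rw [h, succ_mul_coeff_succ_P_eq_sum]
      refine Finset.sum_congr rfl fun i hi => ?_
      rw [ih i (by simpa using hi), ih (n - i) (by omega)]

theorem derivative_P : PowerSeries.derivative ℚ P =
    P ^ 2 + PowerSeries.X * P * PowerSeries.derivative ℚ P := by
  have h : PowerSeries.derivative ℚ P = PowerSeries.derivative ℚ (PowerSeries.X * P) * P := by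
    ext n
    rw [PowerSeries.coeff_mul, Finset.Nat.sum_antidiagonal_eq_sum_range_succ_mk]
    simp only [PowerSeries.coeff_derivative, PowerSeries.coeff_succ_X_mul]
    rw [mul_comm, succ_mul_coeff_succ_P_eq_sum]
    exact Finset.sum_congr rfl fun i _ => by ring
  conv_lhs => rw [h, Derivation.leibniz]
  simp only [smul_eq_mul, PowerSeries.derivative_X]
  ring

/-- The differential equation of `P` gives `(x² P²)' = 2 x P'`, so the coefficients of `P ^ 2`
follow from those of `P'`. -/
theorem coeff_P_sq (n : ℕ) :
    PowerSeries.coeff n (P ^ 2) = 2 * ((n : ℚ) + 2) ^ ((n : ℤ) - 1) / (n ! : ℚ) := by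
  have h : PowerSeries.derivative ℚ (PowerSeries.X * (PowerSeries.X * P ^ 2)) =
      2 * (PowerSeries.X * PowerSeries.derivative ℚ P) := by
    simp only [Derivation.leibniz, smul_eq_mul, PowerSeries.derivative_X, pow_two]
    linear_combination -2 * PowerSeries.X * derivative_P
  have h1 := congrArg (PowerSeries.coeff (n + 1)) h
  rw [show (2 : ℚ⟦X⟧) = PowerSeries.C 2 from (map_ofNat PowerSeries.C 2).symm,
    PowerSeries.coeff_C_mul] at h1
  simp only [PowerSeries.coeff_derivative, PowerSeries.coeff_succ_X_mul] at h1
  have h2 := succ_mul_coeff_succ_P n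
  have h3 : ((n : ℚ) + 2) ≠ 0 := by positivity
  have h4 : (n ! : ℚ) ≠ 0 := by positivity
  apply mul_left_cancel₀ h3
  rw [zpow_sub_one₀ h3, zpow_natCast]
  push_cast at h1
  field_simp
  field_simp at h2
  linear_combination (n ! : ℚ) * h1 + 2 * h2

/-! ### The series `L` and `T_k` -/

theorem choose_mul_div_factorial {m i : ℕ} (hi : i ≤ m) (a b : ℚ) :
    (m.choose i : ℚ) * (a * b) / (m ! : ℚ) = a / (i ! : ℚ) * (b / ((m - i)! : ℚ)) := by
  have h1 : (m ! : ℚ) ≠ 0 := by positivity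
  have h2 : (i ! : ℚ) ≠ 0 := by positivity
  have h3 : ((m - i)! : ℚ) ≠ 0 := by positivity
  rw [Nat.cast_choose ℚ hi]
  field_simp

theorem ncard_leadSet_div_factorial (m r : ℕ) (hr : r ≤ m + 1) :
    ((leadSet (Fin m) (r + 1)).ncard : ℚ) / (m ! : ℚ) =
      ∑ i ∈ Finset.Ico r (m + 1),
        (parkingCount i : ℚ) / (i ! : ℚ) * (parkingCount (m - i) / ((m - i)! : ℚ)) := by
  rw [ncard_leadSet m r hr, Nat.cast_sum, Finset.sum_div]
  refine Finset.sum_congr rfl fun i hi => ?_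
  have := Finset.mem_Ico.1 hi
  push_cast
  exact choose_mul_div_factorial (by omega) _ _

theorem parkingCount_div_factorial (n : ℕ) :
    (parkingCount n : ℚ) / (n ! : ℚ) = PowerSeries.coeff n P := by
  refine coeff_P_unique (c := fun n => (parkingCount n : ℚ) / (n ! : ℚ))
    (by simp [parkingCount_zero]) (fun m => ?_) n
  have h1 : (m ! : ℚ) ≠ 0 := by positivity
  have h2 : ((m : ℚ) + 1) ≠ 0 := by positivity
  have h : ((m : ℚ) + 1) * ((parkingCount (m + 1) : ℚ) / ((m + 1)! : ℚ)) =
      (parkingCount (m + 1) : ℚ) / (m ! : ℚ) := by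
    rw [Nat.factorial_succ]
    push_cast
    field_simp
  rw [h, parkingCount_succ, Nat.cast_sum, Finset.sum_div]
  rw [Finset.sum_congr rfl fun r hr =>
    ncard_leadSet_div_factorial m r (Finset.mem_range.1 hr).le]
  -- After the exchange, index `i` occurs once for each `r ≤ i`, whence the factor `i + 1`.
  rw [Finset.sum_comm' (t' := Finset.range (m + 1)) (s' := fun i => Finset.range (i + 1))]
  · exact Finset.sum_congr rfl fun i _ => by simp
  · intro r i
    simp only [Finset.mem_range, Finset.mem_Ico]
    omega

theorem leadCount_div_factorial {m r : ℕ} (hr : r ≤ m) :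
    (leadCount (m + 1) (r + 1) : ℚ) / (m ! : ℚ) =
      ∑ i ∈ Finset.range (m - r + 1), PowerSeries.coeff i P * PowerSeries.coeff (m - i) P := by
  rw [leadCount_eq (by omega), ncard_leadSet_div_factorial m r (by omega),
    Finset.sum_Ico_eq_sum_range, show m + 1 - r = m - r + 1 by omega, ← Finset.sum_range_reflect]
  refine Finset.sum_congr rfl fun i hi => ?_
  have := Finset.mem_range.1 hi
  rw [parkingCount_div_factorial, parkingCount_div_factorial, mul_comm,
    show r + (m - r + 1 - 1 - i) = m - i by omega, show m - (m - i) = i by omega]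

theorem coeff_sq_P (m : ℕ) : PowerSeries.coeff m (P ^ 2) =
    ∑ i ∈ Finset.range (m + 1), PowerSeries.coeff i P * PowerSeries.coeff (m - i) P := by
  rw [pow_two, PowerSeries.coeff_mul, Finset.Nat.sum_antidiagonal_eq_sum_range_succ_mk]

theorem coeff_zero_T (k : ℕ) : PowerSeries.coeff 0 (T k) = 0 := by
  simp [T]

theorem coeff_succ_T (k m : ℕ) : PowerSeries.coeff (m + 1) (T k) =
    if k ≤ m then
      ∑ i ∈ Finset.range (k + 1), PowerSeries.coeff i P * PowerSeries.coeff (m - i) P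
    else 0 := by
  rw [T, PowerSeries.coeff_mk]
  by_cases hk : k ≤ m
  · rw [if_pos (by omega), if_pos hk, Nat.add_sub_cancel, show m + 1 - k = m - k + 1 by omega,
      leadCount_div_factorial (by omega), Nat.sub_sub_self hk]
  · rw [if_neg (by omega), if_neg hk]

theorem L_eq : L = PowerSeries.X * P ^ 2 := by
  ext n
  cases n with
  | zero => simp [L]
  | succ m =>
    rw [PowerSeries.coeff_succ_X_mul, L, PowerSeries.coeff_mk, if_pos (by omega),
      Nat.add_sub_cancel, ← zero_add 1, ← add_assoc, add_zero,
      leadCount_div_factorial (Nat.zero_le m), coeff_sq_P, Nat.sub_zero]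

theorem T_zero : T 0 = PowerSeries.X * P := by
  ext n
  cases n with
  | zero => simp [coeff_zero_T]
  | succ m => simp [coeff_succ_T, PowerSeries.coeff_succ_X_mul, coeff_zero_P,
      -PowerSeries.coeff_zero_eq_constantCoeff]

/-- Passing from `k` to `k + 1` lengthens each partial convolution by the term `i = k + 1`. The
degree `k + 1` drops out of the range of summation; its coefficient in `T k` was a complete
convolution, that of `P ^ 2`. -/
theorem T_succ (k : ℕ) : T (k + 1) = T k
    + PowerSeries.C (PowerSeries.coeff (k + 1) P) * PowerSeries.X ^ (k + 2) * P
    - PowerSeries.C (PowerSeries.coeff k (P ^ 2)) * PowerSeries.X ^ (k + 1) := by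
  ext n
  rw [map_sub, map_add, mul_assoc, PowerSeries.coeff_C_mul, PowerSeries.coeff_C_mul,
    PowerSeries.coeff_X_pow_mul', PowerSeries.coeff_X_pow]
  cases n with
  | zero => simp [coeff_zero_T, -PowerSeries.coeff_zero_eq_constantCoeff]
  | succ m =>
    rw [coeff_succ_T, coeff_succ_T]
    rcases lt_trichotomy m k with h | rfl | h
    · rw [if_neg (by omega), if_neg (by omega), if_neg (by omega), if_neg (by omega)]
      simp
    · rw [if_neg (by omega), if_pos le_rfl, if_neg (by omega), if_pos rfl, coeff_sq_P]
      simp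
    · rw [if_pos (by omega), if_pos (by omega), if_pos (by omega), if_neg (by omega),
        Finset.sum_range_succ _ (k + 1), show m + 1 - (k + 2) = m - (k + 1) by omega]
      simp

theorem T_eq (k : ℕ) : T k =
    P * (∑ i ∈ Finset.range (k + 1),
      PowerSeries.C (PowerSeries.coeff i P) * PowerSeries.X ^ (i + 1))
    - ∑ i ∈ Finset.range k,
      PowerSeries.C (PowerSeries.coeff i (P ^ 2)) * PowerSeries.X ^ (i + 1) := by
  induction k with
  | zero => simp [T_zero, coeff_zero_P, -PowerSeries.coeff_zero_eq_constantCoeff, mul_comm]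
  | succ k ih =>
    rw [T_succ, ih, Finset.sum_range_succ _ (k + 1),
      Finset.sum_range_succ (fun i =>
        PowerSeries.C (PowerSeries.coeff i (P ^ 2)) * PowerSeries.X ^ (i + 1)) k]
    ring

theorem coeff_P_sq_pred {k : ℕ} (hk : 1 ≤ k) : PowerSeries.coeff (k - 1) (P ^ 2) =
    2 * ((k : ℚ) + 1) ^ ((k : ℤ) - 2) / ((k - 1)! : ℚ) := by
  obtain ⟨k, rfl⟩ := Nat.exists_eq_add_of_le' hk
  rw [Nat.add_sub_cancel, coeff_P_sq]
  push_cast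
  rw [show (k : ℚ) + 1 + 1 = k + 2 by ring, show (k : ℤ) + 1 - 2 = k - 1 by ring]

/-! ### The bivariate series -/

/-- `inXY` as a ring homomorphism. -/
def inXYHom : ℚ⟦X⟧ →+* ℚ⟦X⟧⟦X⟧ :=
  (PowerSeries.rescale (PowerSeries.X : ℚ⟦X⟧)).comp (PowerSeries.map PowerSeries.C)

theorem inXY_pow (f : ℚ⟦X⟧) (n : ℕ) : inXY (f ^ n) = inXY f ^ n :=
  map_pow inXYHom f n

theorem inXY_mul (f g : ℚ⟦X⟧) : inXY (f * g) = inXY f * inXY g :=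
  map_mul inXYHom f g

theorem inXY_add (f g : ℚ⟦X⟧) : inXY (f + g) = inXY f + inXY g :=
  map_add inXYHom f g

theorem coeff_inXY (f : ℚ⟦X⟧) (n : ℕ) : PowerSeries.coeff n (inXY f) =
    PowerSeries.X ^ n * PowerSeries.C (PowerSeries.coeff n f) := by
  rw [inXY, PowerSeries.coeff_rescale, PowerSeries.coeff_map]

theorem inXY_X : inXY PowerSeries.X = x * y := by
  ext1 n
  rw [coeff_inXY, x, y, PowerSeries.coeff_C_mul, PowerSeries.coeff_X, PowerSeries.coeff_X]
  split_ifs with h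
  · simp [h]
  · simp

theorem Txy_functional_equation : Txy - x * inX P
    = y * Txy + x * inX P * (inXY P - 1) - x * y * inXY P ^ 2 := by
  rw [← inXY_pow, mul_assoc x, mul_assoc x, x, inX, y]
  ext1 n
  simp only [map_sub, map_add, PowerSeries.coeff_C_mul]
  cases n with
  | zero =>
    simp [Txy, T_zero, -PowerSeries.coeff_zero_eq_constantCoeff, coeff_inXY, coeff_zero_P,
      PowerSeries.coeff_zero_X_mul]
  | succ k =>
    rw [PowerSeries.coeff_succ_X_mul, PowerSeries.coeff_succ_X_mul, coeff_inXY, coeff_inXY,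
      PowerSeries.coeff_C, PowerSeries.coeff_one, if_neg (by omega), if_neg (by omega), Txy,
      PowerSeries.coeff_mk, PowerSeries.coeff_mk, T_succ]
    ring

theorem isUnit_one_sub_y : IsUnit (1 - y) := by
  rw [PowerSeries.isUnit_iff_constantCoeff]
  simp [y]

theorem partialX_mul (F G : ℚ⟦X⟧⟦X⟧) : partialX (F * G) = partialX F * G + F * partialX G := by
  ext1 n
  simp only [partialX, PowerSeries.coeff_mk, map_add, PowerSeries.coeff_mul, map_sum,
    Derivation.leibniz, smul_eq_mul, Finset.sum_add_distrib]
  rw [add_comm]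
  congr 1
  exact Finset.sum_congr rfl fun _ _ => mul_comm _ _

theorem partialX_sub (F G : ℚ⟦X⟧⟦X⟧) : partialX (F - G) = partialX F - partialX G := by
  ext1 n
  simp [partialX]

theorem partialX_inX (f : ℚ⟦X⟧) : partialX (inX f) = inX (PowerSeries.derivative ℚ f) := by
  ext1 n
  rw [partialX, inX, inX, PowerSeries.coeff_mk, PowerSeries.coeff_C, PowerSeries.coeff_C]
  split_ifs <;> simp

theorem partialX_x : partialX x = 1 := by
  have := partialX_inX PowerSeries.X
  simpa [inX, x, PowerSeries.derivative_X] using this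

theorem partialX_y : partialX y = 0 := by
  ext1 n
  rw [partialX, y, PowerSeries.coeff_mk, PowerSeries.coeff_X]
  split_ifs <;> simp

theorem partialX_one : partialX 1 = 0 := by
  simpa [inX] using partialX_inX 1

theorem partialX_inXY (f : ℚ⟦X⟧) :
    partialX (inXY f) = y * inXY (PowerSeries.derivative ℚ f) := by
  ext1 n
  rw [partialX, PowerSeries.coeff_mk, coeff_inXY, y]
  cases n with
  | zero => simp
  | succ n =>
    rw [PowerSeries.coeff_succ_X_mul, coeff_inXY, PowerSeries.coeff_derivative, Derivation.leibniz,
      Derivation.leibniz_pow,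
      PowerSeries.derivative_X]
    simp
    ring

theorem one_sub_y_mul_Txy :
    (1 - y) * Txy = x * inXY P * (inX P - y * inXY P) := by
  linear_combination Txy_functional_equation

theorem Txy_differential_equation :
    (1 - y) * (Txy + x * partialX Txy)
      = 2 * x * inX P * inXY P + x ^ 2 * inXY P * inX (PowerSeries.derivative ℚ P)
        + x ^ 2 * y * inX P * inXY (PowerSeries.derivative ℚ P)
        - 2 * x * y * inXY (PowerSeries.derivative ℚ P) := by
  -- Since `∂(xT)/∂x = T + x ∂T/∂x`, differentiate `x` times the closed form; the surplus terms
  -- `P(xy)² + xy P(xy) P'(xy)` combine to `P'(xy)` by `hP`.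
  have h := congrArg (fun F => partialX (x * F)) one_sub_y_mul_Txy
  have hP := congrArg inXY derivative_P
  simp only [inXY_add, inXY_mul, inXY_pow, inXY_X] at hP
  simp only [partialX_mul, partialX_sub, partialX_one, partialX_x, partialX_y,
    partialX_inX, partialX_inXY] at h
  linear_combination h + 2 * x * y * hP

end Parking

end

theorem mainTheorem9 :
    -- the differential equations and the closed forms of `L` and `T_0`
    (Parking.L + PowerSeries.X * PowerSeries.derivative ℚ Parking.L
        = 2 * PowerSeries.X * PowerSeries.derivative ℚ Parking.P) ∧
    (Parking.T 0 + PowerSeries.X * PowerSeries.derivative ℚ (Parking.T 0)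
        = 2 * PowerSeries.X * Parking.P
          + PowerSeries.X ^ 2 * PowerSeries.derivative ℚ Parking.P) ∧
    (Parking.L = PowerSeries.X * Parking.P ^ 2) ∧
    (Parking.T 0 = PowerSeries.X * Parking.P) ∧
    -- the recurrence for `T_k` and its solved form
    (∀ k : ℕ, 1 ≤ k →
      Parking.T k = Parking.T (k - 1)
        + PowerSeries.C (((k : ℚ) + 1) ^ ((k : ℤ) - 1) / (k ! : ℚ))
            * PowerSeries.X ^ (k + 1) * Parking.P
        - PowerSeries.C (2 * ((k : ℚ) + 1) ^ ((k : ℤ) - 2) / ((k - 1)! : ℚ))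
            * PowerSeries.X ^ k) ∧
    (∀ k : ℕ, 1 ≤ k →
      Parking.T k =
        Parking.P * (∑ i ∈ Finset.Icc 0 k,
          PowerSeries.C (((i : ℚ) + 1) ^ ((i : ℤ) - 1) / (i ! : ℚ)) * PowerSeries.X ^ (i + 1))
        - ∑ i ∈ Finset.Icc 1 k,
          PowerSeries.C (2 * ((i : ℚ) + 1) ^ ((i : ℤ) - 2) / ((i - 1)! : ℚ))
            * PowerSeries.X ^ i) ∧
    -- the two equations for `T(x,y)`
    ((1 - Parking.y) * (Parking.Txy + Parking.x * Parking.partialX Parking.Txy)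
        = 2 * Parking.x * Parking.inX Parking.P * Parking.inXY Parking.P
          + Parking.x ^ 2 * Parking.inXY Parking.P
              * Parking.inX (PowerSeries.derivative ℚ Parking.P)
          + Parking.x ^ 2 * Parking.y * Parking.inX Parking.P
              * Parking.inXY (PowerSeries.derivative ℚ Parking.P)
          - 2 * Parking.x * Parking.y * Parking.inXY (PowerSeries.derivative ℚ Parking.P)) ∧
    (Parking.Txy - Parking.x * Parking.inX Parking.P
        = Parking.y * Parking.Txy
          + Parking.x * Parking.inX Parking.P * (Parking.inXY Parking.P - 1)
          - Parking.x * Parking.y * Parking.inXY Parking.P ^ 2) ∧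
    -- the closed form of `T(x,y)`; division by the unit `1 - y`
    IsUnit (1 - Parking.y) ∧
    Parking.Txy
      = Parking.x * Parking.inXY Parking.P
          * (Parking.inX Parking.P - Parking.y * Parking.inXY Parking.P)
          * Ring.inverse (1 - Parking.y) := by
  refine ⟨?_, ?_, Parking.L_eq, Parking.T_zero, ?_, ?_, Parking.Txy_differential_equation,
    Parking.Txy_functional_equation, Parking.isUnit_one_sub_y, ?_⟩
  · rw [Parking.L_eq]
    simp only [Derivation.leibniz, smul_eq_mul, PowerSeries.derivative_X, pow_two]
    linear_combination -2 * PowerSeries.X * Parking.derivative_P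
  · rw [Parking.T_zero]
    simp only [Derivation.leibniz, smul_eq_mul, PowerSeries.derivative_X]
    ring
  · intro k hk
    rw [← Parking.coeff_P, ← Parking.coeff_P_sq_pred hk]
    obtain ⟨k, rfl⟩ := Nat.exists_eq_add_of_le' hk
    exact Parking.T_succ k
  · intro k _
    rw [Parking.T_eq]
    congr 1
    · rw [show Finset.Icc 0 k = Finset.range (k + 1) by ext; simp]
      simp only [Parking.coeff_P]
    · rw [show Finset.Icc 1 k = Finset.Ico 1 (k + 1) by ext; simp,
        Finset.sum_Ico_eq_sum_range, Nat.add_sub_cancel]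
      refine Finset.sum_congr rfl fun i _ => ?_
      rw [← Parking.coeff_P_sq_pred (by omega), Nat.add_sub_cancel_left, add_comm i]
  · rw [← Parking.one_sub_y_mul_Txy, mul_comm, ← mul_assoc,
      Ring.inverse_mul_cancel _ Parking.isUnit_one_sub_y, one_mul]
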